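/- Let $T=(V,E,F)$ be a triangulation of a surface without boundary (for example a closed surface), in the wide sense in which distinct sides or corners of a face may coincide in the surface. Let $\ell:E\to\mathbb R_{\ge 0}$ be a length function, that is, $\ell(e_1)\le \ell(e_2)+\ell(e_3)$ whenever $e_1,e_2,e_3$ are, in any order, the three sides of a face. A face is \emph{flattened} by $\ell$ if one of these inequalities is an equality. For each face $f$ let $\Delta_f\subset\mathbb H^2$ be the (possibly degenerate) filled hyperbolic triangle whose side lengths are given by $\ell$, and let $C$ be the conical structure associated with $(T,\ell)$: the metric space obtained from the disjoint union of the $\Delta_f$ by gluing them isometrically along their common sides following the combinatorics of $T$, with the quotient (pseudo-)distance, points at distance $0$ being identified, and points of different components of the surface having infinite distance. Denote by $p_f:\Delta_f\to C$ the canonical maps. Let $\varepsilon>0$, put $\ell_\varepsilon=\ell+\varepsilon$, and let $\Delta'_f$, $C'$ and $p'_f:\Delta'_f\to C'$ be the triangles, the conical structure and the canonical maps associated with $(T,\ell_\varepsilon)$. Then $\ell_\varepsilon$ is a length function which flattens no face, and there is a $1$-Lipschitz map $\Phi:C'\to C$ which respects the triangulation: there are $1$-Lipschitz maps $\varphi_f:\Delta'_f\to\Delta_f$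 $(f\in F)$, sending each vertex to the corresponding vertex and each side into the corresponding side, such that $\Phi\circ p'_f=p_f\circ\varphi_f$ for every face $f$. -/

import Mathlib

/-! ### Triangles in the hyperbolic plane

`UpperHalfPlane` with its `dist` is the hyperbolic plane of curvature `-1`. -/

/-- The geodesic segment `[x y]` of the hyperbolic plane: the set of points between `x` and `y`. -/
def hypSegment (x y : UpperHalfPlane) : Set UpperHalfPlane :=
  {z | dist x z + dist z y = dist x y}

/-- A set is geodesically convex if it contains the geodesic segment between any two of its
points. -/
def HypConvex (s : Set UpperHalfPlane) : Prop :=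
  ∀ x ∈ s, ∀ y ∈ s, hypSegment x y ⊆ s

/-- The geodesic convex hull of a set of points of the hyperbolic plane. -/
def hypHull (s : Set UpperHalfPlane) : Set UpperHalfPlane :=
  ⋂₀ {t | HypConvex t ∧ s ⊆ t}

theorem subset_hypHull (s : Set UpperHalfPlane) : s ⊆ hypHull s :=
  Set.subset_sInter fun _ ht => ht.2

/-- Three numbers satisfying the triangle inequalities are the side lengths of a (possibly flat)
triangle of the hyperbolic plane; the side number `i` is opposite to the vertex number `i`. -/
theorem exists_hyp_triangle (l : Fin 3 → ℝ) (h0 : ∀ i, 0 ≤ l i)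
    (h : ∀ i, l i ≤ l (i + 1) + l (i + 2)) :
    ∃ p : Fin 3 → UpperHalfPlane, ∀ i, dist (p (i + 1)) (p (i + 2)) = l i := by
  have hl0 := h 0
  have hl1 := h 1
  have hl2 := h 2
  have e1 : (1 : Fin 3) + 1 = 2 := rfl
  have e2 : (1 : Fin 3) + 2 = 0 := rfl
  have e3 : (2 : Fin 3) + 1 = 0 := rfl
  have e4 : (2 : Fin 3) + 2 = 1 := rfl
  simp only [zero_add, e1, e2, e3, e4] at hl0 hl1 hl2
  set r := l 1 with hr
  have hr0 : 0 ≤ r := h0 1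
  have hS : 0 ≤ Real.sinh r := Real.sinh_nonneg_iff.2 hr0
  have hpos : ∀ t : ℝ, 0 < Real.cosh r + Real.sinh r * Real.cos t := by
    intro t
    have h1 := Real.neg_one_le_cos t
    have h2 := Real.exp_pos (-r)
    rw [← Real.cosh_sub_sinh] at h2
    nlinarith
  let z : ℝ → UpperHalfPlane := fun t =>
    ⟨⟨Real.sinh r * Real.sin t, Real.cosh r + Real.sinh r * Real.cos t⟩, hpos t⟩
  let q : UpperHalfPlane := ⟨⟨0, Real.exp (l 2)⟩, Real.exp_pos _⟩
  have hz : Continuous z := by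
    rw [UpperHalfPlane.isEmbedding_coe.continuous_iff]
    have : ((↑) : UpperHalfPlane → ℂ) ∘ z = fun t : ℝ =>
        ((Real.sinh r * Real.sin t : ℝ) : ℂ)
          + ((Real.cosh r + Real.sinh r * Real.cos t : ℝ) : ℂ) * Complex.I := by
      funext t
      apply Complex.ext <;> simp [z, -Complex.ofReal_mul, -Complex.ofReal_add]
    rw [this]
    fun_prop
  have hg : Continuous fun t => dist q (z t) := continuous_const.dist hz
  have hz0 : dist q (z 0) = |l 2 - r| := by
    rw [UpperHalfPlane.dist_of_re_eq (by simp [q, z, UpperHalfPlane.re])]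
    simp [q, z, UpperHalfPlane.im, Real.cosh_add_sinh, Real.dist_eq]
  have hzpi : dist q (z Real.pi) = l 2 + r := by
    rw [UpperHalfPlane.dist_of_re_eq (by simp [q, z, UpperHalfPlane.re])]
    simp only [q, z, UpperHalfPlane.im, Real.cos_pi, mul_neg, mul_one, ← sub_eq_add_neg,
      Real.cosh_sub_sinh, Real.log_exp, Real.dist_eq, sub_neg_eq_add]
    exact abs_of_nonneg (add_nonneg (h0 2) hr0)
  obtain ⟨t, -, ht⟩ := intermediate_value_Icc Real.pi_pos.le hg.continuousOn
    (show l 0 ∈ Set.Icc _ _ by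
      simp only [hz0, hzpi]
      exact ⟨abs_le.2 ⟨by linarith, by linarith⟩, by linarith⟩)
  refine ⟨![UpperHalfPlane.I, q, z t], fun i => ?_⟩
  have hIq : dist UpperHalfPlane.I q = l 2 := by
    rw [UpperHalfPlane.dist_of_re_eq (by simp [q, UpperHalfPlane.re])]
    simp [q, UpperHalfPlane.im, Real.dist_eq, abs_of_nonneg (h0 2)]
  have hzI : dist (z t) UpperHalfPlane.I = r := by
    rw [UpperHalfPlane.dist_eq_iff_dist_coe_center_eq, Complex.dist_eq_re_im]
    simp only [z, UpperHalfPlane.coe_re, UpperHalfPlane.coe_im, UpperHalfPlane.center_re,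
      UpperHalfPlane.center_im, UpperHalfPlane.I_re, UpperHalfPlane.I_im]
    rw [show (Real.sinh r * Real.sin t - 0) ^ 2
        + (Real.cosh r + Real.sinh r * Real.cos t - 1 * Real.cosh r) ^ 2 = Real.sinh r ^ 2 by
      linear_combination Real.sinh r ^ 2 * Real.sin_sq_add_cos_sq t, Real.sqrt_sq hS, one_mul]
  fin_cases i
  · exact ht
  · exact hzI
  · exact hIq

/-! ### Triangulated surfaces -/

/-- A triangulation of a surface without boundary, with sets of vertices `V`, edges `E` and faces
`F`. It is a triangulation in the wide sense: distinct sides, or distinct corners, of a face may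
be the same edge or vertex (a closed surface may have a triangulation with only one vertex).
The three corners of a face are numbered by `Fin 3`, and the side number `i` is opposite to the
corner number `i`, so that it joins the corners `i + 1` and `i + 2`. Each edge carries an auxiliary
orientation, and `forward f i` says that the side `i` of `f` runs along its edge from the corner
`i + 1` to the corner `i + 2`.

The last four fields say that the complex is a surface: each edge is exactly two of the sides of
the faces, and the corners at a vertex form exactly one cycle. The surface is closed
if `F` is finite. -/
structure SurfaceTriangulation (V E F : Type*) where
  /-- the vertex at a corner of a face -/
  corner : F → Fin 3 → V
  /-- the edge which is a side of a face -/
  side : F → Fin 3 → E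
  /-- whether the side runs from the corner `i + 1` to the corner `i + 2` -/
  forward : F → Fin 3 → Bool
  /-- the first vertex of an edge -/
  source : E → V
  /-- the last vertex of an edge -/
  target : E → V
  source_eq : ∀ f i, corner f (bif forward f i then i + 1 else i + 2) = source (side f i)
  target_eq : ∀ f i, corner f (bif forward f i then i + 2 else i + 1) = target (side f i)
  two_sides : ∀ e, {s : F × Fin 3 | side s.1 s.2 = e}.ncard = 2
  corner_surjective : ∀ v, ∃ f i, corner f i = v
  finite_star : ∀ v, {c : F × Fin 3 | corner c.1 c.2 = v}.Finite
  /-- two corners at the same vertex are related by turning around the vertex, crossing the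
  edges which start or end there -/
  link_connected : ∀ c d : F × Fin 3, corner c.1 c.2 = corner d.1 d.2 →
    Relation.EqvGen (fun a b : F × Fin 3 => ∃ i j, side a.1 i = side b.1 j ∧
      ((a.2 = (bif forward a.1 i then i + 1 else i + 2) ∧
          b.2 = (bif forward b.1 j then j + 1 else j + 2)) ∨
        (a.2 = (bif forward a.1 i then i + 2 else i + 1) ∧
          b.2 = (bif forward b.1 j then j + 2 else j + 1)))) c d

/-- A length function `ℓ : E → ℝ≥0` on a triangulation; a metric triangulation is a triangulation
together with a length function. -/
structure LengthFunction {V E F : Type*} (T : SurfaceTriangulation V E F) where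
  /-- the length of an edge -/
  len : E → ℝ
  nonneg : ∀ e, 0 ≤ len e
  triangle_le : ∀ f i, len (T.side f i) ≤ len (T.side f (i + 1)) + len (T.side f (i + 2))

namespace LengthFunction

variable {V E F : Type*} {T : SurfaceTriangulation V E F}

/-- The length function `ℓ + ε`. -/
def perturb (ℓ : LengthFunction T) (ε : ℝ) (hε : 0 ≤ ε) : LengthFunction T where
  len e := ℓ.len e + ε
  nonneg e := add_nonneg (ℓ.nonneg e) hε
  triangle_le f i := by linarith [ℓ.triangle_le f i]

/-- `ℓ` flattens the face `f` if one of its triangle inequalities is an equality. -/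
def FlattensFace (ℓ : LengthFunction T) (f : F) : Prop :=
  ∃ i, ℓ.len (T.side f i) = ℓ.len (T.side f (i + 1)) + ℓ.len (T.side f (i + 2))

theorem exists_vertices (ℓ : LengthFunction T) (f : F) :
    ∃ p : Fin 3 → UpperHalfPlane, ∀ i, dist (p (i + 1)) (p (i + 2)) = ℓ.len (T.side f i) :=
  exists_hyp_triangle _ (fun i => ℓ.nonneg (T.side f i)) (ℓ.triangle_le f)

/-- The vertices of a hyperbolic triangle whose side lengths are those of the face `f` (such a
triangle is unique up to isometry). -/
noncomputable def vertex (ℓ : LengthFunction T) (f : F) : Fin 3 → UpperHalfPlane :=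
  (ℓ.exists_vertices f).choose

theorem dist_vertex (ℓ : LengthFunction T) (f : F) (i : Fin 3) :
    dist (ℓ.vertex f (i + 1)) (ℓ.vertex f (i + 2)) = ℓ.len (T.side f i) :=
  (ℓ.exists_vertices f).choose_spec i

/-- The filled triangle `Δ_f` in the hyperbolic plane. -/
def triangle (ℓ : LengthFunction T) (f : F) : Set UpperHalfPlane :=
  hypHull (Set.range (ℓ.vertex f))

/-- The side number `i` of the triangle `Δ_f`. -/
def triangleSide (ℓ : LengthFunction T) (f : F) (i : Fin 3) : Set UpperHalfPlane :=
  hypSegment (ℓ.vertex f (i + 1)) (ℓ.vertex f (i + 2))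

/-- The point of the triangle `Δ_f` at which its side number `i` begins, for the orientation of
the corresponding edge. -/
noncomputable def sideStart (ℓ : LengthFunction T) (f : F) (i : Fin 3) : UpperHalfPlane :=
  ℓ.vertex f (bif T.forward f i then i + 1 else i + 2)

/-- The disjoint union of the triangles `Δ_f`. -/
structure Point (ℓ : LengthFunction T) where
  /-- the face whose triangle contains the point -/
  face : F
  /-- the position in the hyperbolic plane -/
  pos : UpperHalfPlane
  mem : pos ∈ ℓ.triangle face

/-- The identifications: two points which lie on sides with the same edge `e` are glued if they
have the same position along `e`. -/
def Glued (ℓ : LengthFunction T) (x y : ℓ.Point) : Prop :=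
  ∃ i j, T.side x.face i = T.side y.face j ∧
    x.pos ∈ ℓ.triangleSide x.face i ∧ y.pos ∈ ℓ.triangleSide y.face j ∧
    dist (ℓ.sideStart x.face i) x.pos = dist (ℓ.sideStart y.face j) y.pos

/-- `ℓ.Chain x y r`: there is a chain of total length `r` from `x` to `y`, which moves inside the
triangles, and jumps (at no cost) between glued points. -/
inductive Chain (ℓ : LengthFunction T) : ℓ.Point → ℓ.Point → ℝ → Prop
  | refl (x : ℓ.Point) : Chain ℓ x x 0
  | move {x y z : ℓ.Point} {r : ℝ} : Chain ℓ x y r → y.face = z.face →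
      Chain ℓ x z (r + dist y.pos z.pos)
  | glue {x y z : ℓ.Point} {r : ℝ} : Chain ℓ x y r → ℓ.Glued y z → Chain ℓ x z r

variable {ℓ : LengthFunction T}

theorem Glued.symm {x y : ℓ.Point} (h : ℓ.Glued x y) : ℓ.Glued y x := by
  obtain ⟨i, j, h1, h2, h3, h4⟩ := h
  exact ⟨j, i, h1.symm, h3, h2, h4.symm⟩

theorem Chain.nonneg {x y : ℓ.Point} {r : ℝ} (h : ℓ.Chain x y r) : 0 ≤ r := by
  induction h with
  | refl => exact le_rfl
  | move _ _ ih => exact add_nonneg ih dist_nonneg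
  | glue _ _ ih => exact ih

theorem Chain.trans {x y z : ℓ.Point} {r s : ℝ} (h : ℓ.Chain x y r) (h' : ℓ.Chain y z s) :
    ℓ.Chain x z (r + s) := by
  induction h' with
  | refl => simpa using h
  | move _ hf ih => rw [← add_assoc]; exact ih.move hf
  | glue _ hg ih => exact ih.glue hg

theorem Chain.symm {x y : ℓ.Point} {r : ℝ} (h : ℓ.Chain x y r) : ℓ.Chain y x r := by
  induction h with
  | refl => exact Chain.refl _
  | @move y z r _ hf ih =>
    have h1 : ℓ.Chain z y (0 + dist z.pos y.pos) := (Chain.refl z).move hf.symm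
    have h2 := h1.trans ih
    rwa [zero_add, dist_comm, add_comm] at h2
  | @glue y z r _ hg ih =>
    have h2 := ((Chain.refl z).glue hg.symm).trans ih
    rwa [zero_add] at h2

/-- The quotient pseudo-distance on the disjoint union of the triangles: the infimum of the lengths
of the chains (it is infinite only between different components of the surface). -/
noncomputable instance instPseudoEMetricSpacePoint (ℓ : LengthFunction T) : PseudoEMetricSpace ℓ.Point where
  edist x y := ⨅ (r : ℝ) (_ : ℓ.Chain x y r), ENNReal.ofReal r
  edist_self x := by
    refine le_antisymm ?_ bot_le
    exact (iInf₂_le (0 : ℝ) (Chain.refl x)).trans (by simp)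
  edist_comm x y := by
    apply le_antisymm <;>
    exact le_iInf₂ fun r hr => iInf₂_le (f := fun r _ => ENNReal.ofReal r) r hr.symm
  edist_triangle x y z := by
    refine ENNReal.le_of_forall_pos_le_add fun δ hδ hfin => ?_
    have hx : (⨅ (r : ℝ) (_ : ℓ.Chain x y r), ENNReal.ofReal r) ≠ ⊤ :=
      (lt_of_le_of_lt le_self_add hfin).ne
    have hz : (⨅ (r : ℝ) (_ : ℓ.Chain y z r), ENNReal.ofReal r) ≠ ⊤ :=
      (lt_of_le_of_lt le_add_self hfin).ne
    have hδ2 : ((δ / 2 : NNReal) : ENNReal) ≠ 0 := by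
      simpa using hδ.ne'
    obtain ⟨r, hr⟩ := iInf_lt_iff.1 (ENNReal.lt_add_right hx hδ2)
    obtain ⟨hr, hr'⟩ := iInf_lt_iff.1 hr
    obtain ⟨s, hs⟩ := iInf_lt_iff.1 (ENNReal.lt_add_right hz hδ2)
    obtain ⟨hs, hs'⟩ := iInf_lt_iff.1 hs
    calc (⨅ (r : ℝ) (_ : ℓ.Chain x z r), ENNReal.ofReal r)
        ≤ ENNReal.ofReal (r + s) := iInf₂_le (r + s) (hr.trans hs)
      _ = ENNReal.ofReal r + ENNReal.ofReal s := ENNReal.ofReal_add hr.nonneg hs.nonneg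
      _ ≤ _ := add_le_add hr'.le hs'.le
      _ = _ := by
        rw [add_add_add_comm, ← ENNReal.coe_add, add_halves]

/-- The conical hyperbolic surface `C` obtained by gluing the triangles `Δ_f` along their
common sides: the (extended) metric space associated with the quotient pseudo-distance. -/
abbrev ConeStructure (ℓ : LengthFunction T) : Type _ :=
  SeparationQuotient ℓ.Point

/-- The canonical map `Δ_f → C`. -/
noncomputable def toCone (ℓ : LengthFunction T) (f : F) (x : ℓ.triangle f) : ℓ.ConeStructure :=
  SeparationQuotient.mk ⟨f, x.1, x.2⟩

end LengthFunction

/-! Place each triangle in the hyperboloid model and let the map preserve projective barycentric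
coordinates with respect to the vertices. If `G` is the Gram form of the vertex vectors, points with
coordinates `l`, `m` satisfy `cosh² d = G(l,m)² / (G(l,l) G(m,m))`. The whole question is therefore
how `G` changes when the three sides grow by `ε`.

The key fact is that the cone `G ≤ 0` stays in the cone `G_ε ≤ 0` (`cosh_add_form_nonpos`). Its
infinitesimal version, `sinh_form_nonpos`, says that the derivative of `G` is nonpositive on that
cone; the addition formula for `cosh` passes from it to any `ε` at once. Restricted to the pencil `l
- t m`, the inclusion of cones says that the hyperbolic angle between `l` and `m` grows
(`cross_sq_mul_le`), so the map from the larger triangle to the smaller one is `1`-Lipschitz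
(`dist_baryPoint_le`).

On a side, the coordinates of a point are determined up to scale by its position and the length of
the edge, so its image is the same from both adjacent triangles. Gluings are thus respected, chains
are sent to chains that are no longer, and the triangle maps induce a `1`-Lipschitz map of the
quotients. -/

/-! ### Growth of the sides of a triangle and isotropic vectors -/

/-- With `X = q r sinh a`, `k = q sinh c + r sinh b` and `H = q cosh c + r cosh b`, this is the
value at `s = X` of `s² - 2 s k H + (q² + r² + 2 q r cosh a) k²`. As a polynomial in `q`, `r` it has
only nonnegative coefficients. -/
theorem sinh_form_discriminant_nonneg {a b c q r : ℝ} (ha : a ≤ b + c)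
    (h0b : 0 ≤ b) (h0c : 0 ≤ c) (hq : 0 ≤ q) (hr : 0 ≤ r) :
    0 ≤ (q * r * Real.sinh a) ^ 2
      - 2 * (q * r * Real.sinh a) * ((q * Real.sinh c + r * Real.sinh b)
        * (q * Real.cosh c + r * Real.cosh b))
      + (q ^ 2 + r ^ 2 + 2 * q * r * Real.cosh a) * (q * Real.sinh c + r * Real.sinh b) ^ 2 := by
  have hsb := Real.sinh_nonneg_iff.2 h0b
  have hsc := Real.sinh_nonneg_iff.2 h0c
  have h1 : 0 ≤ Real.sinh b - Real.sinh (a - c) :=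
    sub_nonneg.2 (Real.sinh_le_sinh.2 (by linarith))
  have h2 : 0 ≤ Real.sinh c - Real.sinh (a - b) :=
    sub_nonneg.2 (Real.sinh_le_sinh.2 (by linarith))
  have hd : 0 ≤ Real.cosh (b + c) - Real.cosh (b - c) := by
    rw [Real.cosh_add, Real.cosh_sub]
    linarith [mul_nonneg hsb hsc]
  have hda := Real.cosh_pos (b - c)
  have hS : 0 ≤ Real.cosh (b + c - a) - 1 := sub_nonneg.2 (Real.one_le_cosh _)
  -- The coefficient of `q² r²`, written as a sum of three nonnegative terms.
  have key : Real.sinh a ^ 2 + Real.sinh b ^ 2 + Real.sinh c ^ 2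
      + 4 * Real.cosh a * Real.sinh b * Real.sinh c
      - 2 * Real.sinh a * (Real.sinh b * Real.cosh c + Real.cosh b * Real.sinh c)
      = (Real.cosh a - Real.cosh (b - c)) ^ 2
        + Real.cosh (b - c) * (Real.cosh (b + c) - Real.cosh (b - c))
        + 2 * (Real.cosh (b + c - a) - 1) := by
    rw [Real.cosh_sub (b + c), Real.sinh_add, Real.cosh_add, Real.cosh_sub]
    have e1 := Real.cosh_sq a
    have e2 := Real.cosh_sq b
    have e3 := Real.cosh_sq c
    linear_combination (-1) * e1 + (-Real.sinh c ^ 2) * e2 + (-Real.cosh b ^ 2) * e3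
      - e2
  rw [Real.sinh_sub] at h1 h2
  have key' : 0 ≤ Real.sinh a ^ 2 + Real.sinh b ^ 2 + Real.sinh c ^ 2
      + 4 * Real.cosh a * Real.sinh b * Real.sinh c
      - 2 * Real.sinh a * (Real.sinh b * Real.cosh c + Real.cosh b * Real.sinh c) := by
    rw [key]; positivity
  have : (q * r * Real.sinh a) ^ 2
      - 2 * (q * r * Real.sinh a) * ((q * Real.sinh c + r * Real.sinh b)
        * (q * Real.cosh c + r * Real.cosh b))
      + (q ^ 2 + r ^ 2 + 2 * q * r * Real.cosh a) * (q * Real.sinh c + r * Real.sinh b) ^ 2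
      = q ^ 4 * Real.sinh c ^ 2 + r ^ 4 * Real.sinh b ^ 2
        + q ^ 3 * r * (2 * Real.sinh c * (Real.sinh b
          - (Real.sinh a * Real.cosh c - Real.cosh a * Real.sinh c)))
        + q * r ^ 3 * (2 * Real.sinh b * (Real.sinh c
          - (Real.sinh a * Real.cosh b - Real.cosh a * Real.sinh b)))
        + q ^ 2 * r ^ 2 * (Real.sinh a ^ 2 + Real.sinh b ^ 2 + Real.sinh c ^ 2
      + 4 * Real.cosh a * Real.sinh b * Real.sinh c
      - 2 * Real.sinh a * (Real.sinh b * Real.cosh c + Real.cosh b * Real.sinh c)) := by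
    ring
  rw [this]
  positivity

/-- The case of `sinh_form_nonpos` in which the coordinate `-p` has sign opposite to `q` and `r`.
After multiplication by `k²`, the hypothesis says that the quadratic of
`sinh_form_discriminant_nonneg` is nonpositive at `s = p k`. It is decreasing up to `k H` and
nonnegative at `X ≤ k H`, so `p k < X` is impossible. -/
theorem sinh_form_le_of_cosh_form_le {a b c p q r : ℝ} (ha : a ≤ b + c)
    (h0b : 0 ≤ b) (h0c : 0 ≤ c) (hq : 0 ≤ q) (hr : 0 ≤ r)
    (h : p ^ 2 + q ^ 2 + r ^ 2 + 2 * q * r * Real.cosh a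
      ≤ 2 * p * (q * Real.cosh c + r * Real.cosh b)) :
    q * r * Real.sinh a ≤ p * (q * Real.sinh c + r * Real.sinh b) := by
  by_contra! hX
  have hD := sinh_form_discriminant_nonneg ha h0b h0c hq hr
  have hsb := Real.sinh_nonneg_iff.2 h0b
  have hsc := Real.sinh_nonneg_iff.2 h0c
  have hcb := Real.cosh_pos b
  have hcc := Real.cosh_pos c
  have hS : Real.sinh a ≤ Real.sinh b * Real.cosh c + Real.cosh b * Real.sinh c := by
    rw [← Real.sinh_add]; exact Real.sinh_le_sinh.2 ha
  set X := q * r * Real.sinh a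
  set k := q * Real.sinh c + r * Real.sinh b
  set H := q * Real.cosh c + r * Real.cosh b
  have hXH : X ≤ k * H := by
    have h1 := mul_le_mul_of_nonneg_left hS (mul_nonneg hq hr)
    have h2 : k * H = q * r * (Real.sinh b * Real.cosh c + Real.cosh b * Real.sinh c)
        + q ^ 2 * (Real.sinh c * Real.cosh c) + r ^ 2 * (Real.sinh b * Real.cosh b) := by
      simp only [k, H]; ring
    rw [h2]
    have : 0 ≤ q ^ 2 * (Real.sinh c * Real.cosh c) := by positivity
    have : 0 ≤ r ^ 2 * (Real.sinh b * Real.cosh b) := by positivity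
    linarith
  have hf := mul_le_mul_of_nonneg_right h (sq_nonneg k)
  -- The positive product is the value of the quadratic at `p k` minus its value at `X`.
  nlinarith [mul_pos (sub_pos.2 hX) (show 0 < 2 * (k * H) - X - p * k by linarith)]

/-- If a vector is not positive for the Gram form of a hyperbolic triangle, then its square
decreases when the three sides of the triangle grow at the same speed. -/
theorem sinh_form_nonpos {a b c x y z : ℝ} (ha : a ≤ b + c) (hb : b ≤ a + c)
    (hc : c ≤ a + b) (h0a : 0 ≤ a) (h0b : 0 ≤ b) (h0c : 0 ≤ c)
    (h : x ^ 2 + y ^ 2 + z ^ 2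
      + 2 * (y * z * Real.cosh a + x * z * Real.cosh b + x * y * Real.cosh c) ≤ 0) :
    y * z * Real.sinh a + x * z * Real.sinh b + x * y * Real.sinh c ≤ 0 := by
  -- When no two signs are opposite, every term of the Gram form is nonnegative, so the vector is
  -- zero.
  have same : ∀ x' y' z' : ℝ, 0 ≤ x' * y' → 0 ≤ y' * z' → 0 ≤ x' * z' →
      x' ^ 2 + y' ^ 2 + z' ^ 2
      + 2 * (y' * z' * Real.cosh a + x' * z' * Real.cosh b + x' * y' * Real.cosh c) ≤ 0 →
      y' * z' * Real.sinh a + x' * z' * Real.sinh b + x' * y' * Real.sinh c ≤ 0 := by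
    intro x y z h1 h2 h3 h
    have i1 := mul_nonneg h2 (Real.cosh_pos a).le
    have i2 := mul_nonneg h3 (Real.cosh_pos b).le
    have i3 := mul_nonneg h1 (Real.cosh_pos c).le
    have hx : x = 0 := by nlinarith [sq_nonneg x, sq_nonneg y, sq_nonneg z]
    have hy : y = 0 := by nlinarith [sq_nonneg x, sq_nonneg y, sq_nonneg z]
    simp [hx, hy]
  rcases le_total 0 x with hx | hx <;> rcases le_total 0 y with hy | hy <;>
    rcases le_total 0 z with hz | hz
  · exact same x y z (mul_nonneg hx hy) (mul_nonneg hy hz) (mul_nonneg hx hz) h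
  · have := sinh_form_le_of_cosh_form_le (a := c) (b := a) (c := b) (p := -z)
      hc h0a h0b hx hy (by linarith)
    linarith
  · have := sinh_form_le_of_cosh_form_le (a := b) (b := c) (c := a) (p := -y)
      (by linarith) h0c h0a hz hx (by linarith)
    linarith
  · have := sinh_form_le_of_cosh_form_le (p := x) ha h0b h0c
      (neg_nonneg.2 hy) (neg_nonneg.2 hz) (by linarith)
    linarith
  · have := sinh_form_le_of_cosh_form_le (p := -x) ha h0b h0c hy hz (by linarith)
    linarith
  · have := sinh_form_le_of_cosh_form_le (a := b) (b := c) (c := a) (p := y)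
      (by linarith) h0c h0a (neg_nonneg.2 hz) (neg_nonneg.2 hx) (by linarith)
    linarith
  · have := sinh_form_le_of_cosh_form_le (a := c) (b := a) (c := b) (p := z)
      hc h0a h0b (neg_nonneg.2 hx) (neg_nonneg.2 hy) (by linarith)
    linarith
  · exact same x y z (mul_nonneg_of_nonpos_of_nonpos hx hy)
      (mul_nonneg_of_nonpos_of_nonpos hy hz) (mul_nonneg_of_nonpos_of_nonpos hx hz) h

/-- By the addition formula, `G_ε = cosh ε · G + 2 sinh ε · S - (cosh ε - 1)(x² + y² + z²)`, where
`S` is the form of `sinh_form_nonpos`; all three terms are nonpositive. -/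
theorem cosh_add_form_nonpos {a b c ε x y z : ℝ} (ha : a ≤ b + c) (hb : b ≤ a + c)
    (hc : c ≤ a + b) (h0a : 0 ≤ a) (h0b : 0 ≤ b) (h0c : 0 ≤ c) (hε : 0 ≤ ε)
    (h : x ^ 2 + y ^ 2 + z ^ 2
      + 2 * (y * z * Real.cosh a + x * z * Real.cosh b + x * y * Real.cosh c) ≤ 0) :
    x ^ 2 + y ^ 2 + z ^ 2
      + 2 * (y * z * Real.cosh (a + ε) + x * z * Real.cosh (b + ε)
        + x * y * Real.cosh (c + ε)) ≤ 0 := by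
  have hQ := sinh_form_nonpos ha hb hc h0a h0b h0c h
  simp only [Real.cosh_add]
  have h1 := mul_nonneg (Real.cosh_pos ε).le (neg_nonneg.2 h)
  have h2 := mul_nonneg (Real.sinh_nonneg_iff.2 hε) (neg_nonneg.2 hQ)
  have h3 := mul_nonneg (sub_nonneg.2 (Real.one_le_cosh ε))
    (by positivity : 0 ≤ x ^ 2 + y ^ 2 + z ^ 2)
  linarith

/-! ### Comparison of binary quadratic forms -/

/-- If a binary quadratic form is nonpositive wherever another one is, then the angle between the
two basis vectors is larger for the former. -/
theorem cross_sq_mul_le {u v w u' v' w' : ℝ} (hu : 0 < u) (hv : 0 < v) (hw : 0 < w)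
    (hu' : 0 < u') (hv' : 0 < v') (huv : u * v ≤ w ^ 2)
    (h : ∀ t, u - 2 * t * w + t ^ 2 * v ≤ 0 → u' - 2 * t * w' + t ^ 2 * v' ≤ 0) :
    w ^ 2 * (u' * v') ≤ w' ^ 2 * (u * v) := by
  set s := √(w ^ 2 - u * v) with hs
  have hs2 : s ^ 2 = w ^ 2 - u * v := Real.sq_sqrt (by linarith)
  have hsw : s < w := by
    rw [hs, Real.sqrt_lt' hw]; nlinarith [mul_pos hu hv]
  have hs0 : 0 ≤ s := Real.sqrt_nonneg _
  -- The hypothesis is only used at the two roots `t = (w ± s) / v` of the first form, with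
  -- denominators cleared.
  have root : ∀ σ : ℝ, σ ^ 2 = w ^ 2 - u * v →
      u' * v ^ 2 - 2 * (w + σ) * v * w' + (w + σ) ^ 2 * v' ≤ 0 := by
    intro σ hσ
    have h1 := h ((w + σ) / v) (le_of_eq (by field_simp; linear_combination hσ))
    have h2 := mul_nonpos_of_nonneg_of_nonpos (sq_nonneg v) h1
    calc _ = v ^ 2 * (u' - 2 * ((w + σ) / v) * w' + ((w + σ) / v) ^ 2 * v') := by
          field_simp
      _ ≤ 0 := h2
  have h1 := root s hs2
  have h2 := root (-s) (by rw [neg_sq, hs2])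
  -- Weighting each root inequality by the conjugate `w ∓ s` eliminates `s`, since `(w - s)(w + s) =
  -- u v`.
  have h3 := mul_nonneg (show 0 ≤ w - s by linarith) (neg_nonneg.2 h1)
  have h4 := mul_nonneg (show 0 ≤ w + s by linarith) (neg_nonneg.2 h2)
  have h5 : 0 ≤ 2 * v * (2 * u * v * w' - w * (u' * v + u * v')) := by
    have : 2 * v * (2 * u * v * w' - w * (u' * v + u * v'))
        = (w - s) * -(u' * v ^ 2 - 2 * (w + s) * v * w' + (w + s) ^ 2 * v')
        + (w + s) * -(u' * v ^ 2 - 2 * (w + -s) * v * w' + (w + -s) ^ 2 * v') := by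
      linear_combination (4 * v * w' - 2 * w * v') * hs2
    rw [this]; exact add_nonneg h3 h4
  have h6 : w * (u' * v + u * v') ≤ 2 * u * v * w' := by
    linarith [nonneg_of_mul_nonneg_right h5 (by positivity : 0 < 2 * v)]
  have h7 := pow_le_pow_left₀ (by positivity) h6 2
  -- This square gives `(u' v + u v')² ≥ 4 u v u' v'`, which removes the sum from `h7`.
  have h8 := mul_nonneg (sq_nonneg w) (sq_nonneg (u' * v - u * v'))
  have h9 : 0 ≤ 4 * u * v * (w' ^ 2 * (u * v) - w ^ 2 * (u' * v')) := by linarith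
  linarith [nonneg_of_mul_nonneg_right h9 (by positivity : 0 < 4 * u * v)]

/-! ### The hyperboloid model -/

/-- The Lorentz form on `ℝ³`, in coordinates in which two of the basis vectors are isotropic. -/
noncomputable def lorentz (v w : ℝ × ℝ × ℝ) : ℝ :=
  (v.1 * w.2.2 + v.2.2 * w.1) / 2 - v.2.1 * w.2.1

theorem lorentz_comm (v w : ℝ × ℝ × ℝ) : lorentz v w = lorentz w v := by
  simp only [lorentz]; ring

theorem lorentz_add_left (u v w : ℝ × ℝ × ℝ) :
    lorentz (u + v) w = lorentz u w + lorentz v w := by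
  simp only [lorentz, Prod.fst_add, Prod.snd_add]; ring

theorem lorentz_add_right (u v w : ℝ × ℝ × ℝ) :
    lorentz u (v + w) = lorentz u v + lorentz u w := by
  simp only [lorentz, Prod.fst_add, Prod.snd_add]; ring

theorem lorentz_smul_left (c : ℝ) (v w : ℝ × ℝ × ℝ) :
    lorentz (c • v) w = c * lorentz v w := by
  simp only [lorentz, Prod.smul_fst, Prod.smul_snd, smul_eq_mul]; ring

theorem lorentz_smul_right (c : ℝ) (v w : ℝ × ℝ × ℝ) :
    lorentz v (c • w) = c * lorentz v w := by
  simp only [lorentz, Prod.smul_fst, Prod.smul_snd, smul_eq_mul]; ring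

/-- The vector of the hyperboloid which represents a point of the upper half-plane. -/
noncomputable def hypVec (z : UpperHalfPlane) : ℝ × ℝ × ℝ :=
  (1 / z.im, z.re / z.im, (z.re ^ 2 + z.im ^ 2) / z.im)

theorem lorentz_hypVec (z w : UpperHalfPlane) :
    lorentz (hypVec z) (hypVec w) = Real.cosh (dist z w) := by
  have hz := z.im_pos.ne'
  have hw := w.im_pos.ne'
  rw [UpperHalfPlane.cosh_dist']
  simp only [lorentz, hypVec]
  field_simp
  ring

theorem lorentz_hypVec_self (z : UpperHalfPlane) : lorentz (hypVec z) (hypVec z) = 1 := by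
  rw [lorentz_hypVec, dist_self, Real.cosh_zero]

/-- The future timelike vectors, which are the positive multiples of the vectors of the
hyperboloid. -/
def FutureTimelike (v : ℝ × ℝ × ℝ) : Prop :=
  0 < v.1 ∧ 0 < lorentz v v

theorem futureTimelike_hypVec (z : UpperHalfPlane) : FutureTimelike (hypVec z) :=
  ⟨one_div_pos.2 z.im_pos, by rw [lorentz_hypVec_self]; exact one_pos⟩

open Classical in
/-- The point of the upper half-plane on the ray of a future timelike vector. -/
noncomputable def hypPoint (v : ℝ × ℝ × ℝ) : UpperHalfPlane :=
  if h : FutureTimelike v then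
    ⟨⟨v.2.1 / v.1, √(lorentz v v) / v.1⟩, div_pos (Real.sqrt_pos.2 h.2) h.1⟩
  else UpperHalfPlane.I

namespace FutureTimelike

variable {v w : ℝ × ℝ × ℝ}

theorem sqrt_smul_hypVec (hv : FutureTimelike v) :
    √(lorentz v v) • hypVec (hypPoint v) = v := by
  have h1 := hv.1
  have h2 := Real.sqrt_pos.2 hv.2
  have h3 := Real.sq_sqrt hv.2.le
  have hre : (hypPoint v).re = v.2.1 / v.1 := by rw [hypPoint, dif_pos hv]; rfl
  have him : (hypPoint v).im = √(lorentz v v) / v.1 := by rw [hypPoint, dif_pos hv]; rfl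
  set s := √(lorentz v v)
  simp only [lorentz] at h3
  obtain ⟨a, b, c⟩ := v
  simp only [hypVec, hre, him, Prod.smul_mk, smul_eq_mul] at *
  refine Prod.ext ?_ (Prod.ext ?_ ?_)
  · field_simp
  · field_simp
  · simp only
    field_simp
    linear_combination h3

theorem lorentz_eq (hv : FutureTimelike v) (hw : FutureTimelike w) :
    lorentz v w = √(lorentz v v) * √(lorentz w w) *
      Real.cosh (dist (hypPoint v) (hypPoint w)) := by
  conv_lhs => rw [← hv.sqrt_smul_hypVec, ← hw.sqrt_smul_hypVec]
  rw [lorentz_smul_left, lorentz_smul_right, lorentz_hypVec]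
  ring

theorem lorentz_pos (hv : FutureTimelike v) (hw : FutureTimelike w) : 0 < lorentz v w := by
  rw [hv.lorentz_eq hw]
  exact mul_pos (mul_pos (Real.sqrt_pos.2 hv.2) (Real.sqrt_pos.2 hw.2)) (Real.cosh_pos _)

theorem mul_le_sq (hv : FutureTimelike v) (hw : FutureTimelike w) :
    lorentz v v * lorentz w w ≤ lorentz v w ^ 2 := by
  rw [hv.lorentz_eq hw, mul_pow, mul_pow, Real.sq_sqrt hv.2.le, Real.sq_sqrt hw.2.le]
  exact le_mul_of_one_le_right (mul_pos hv.2 hw.2).le (one_le_pow₀ (Real.one_le_cosh _))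

theorem smul_add_smul (hv : FutureTimelike v) (hw : FutureTimelike w) {α β : ℝ}
    (hα : 0 ≤ α) (hβ : 0 ≤ β) (h : 0 < α + β) : FutureTimelike (α • v + β • w) := by
  have h1 := hv.1
  have h2 := hw.1
  have h3 := hv.2
  have h4 := hw.2
  have h5 := hv.lorentz_pos hw
  constructor
  · simp only [Prod.fst_add, Prod.smul_fst, smul_eq_mul]
    rcases hα.eq_or_lt with rfl | hα
    · have : 0 < β := by linarith
      positivity
    · positivity
  · simp only [lorentz_add_left, lorentz_add_right, lorentz_smul_left, lorentz_smul_right,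
      lorentz_comm w v]
    rcases hα.eq_or_lt with rfl | hα
    · have : 0 < β := by linarith
      positivity
    · positivity

/-- The equality case of the reversed Cauchy–Schwarz inequality `mul_le_sq`: the `cosh` of the
distance is then at most `1`. -/
theorem hypPoint_eq_hypPoint (hv : FutureTimelike v) (hw : FutureTimelike w)
    (h : lorentz v w ≤ √(lorentz v v) * √(lorentz w w)) : hypPoint v = hypPoint w := by
  rw [hv.lorentz_eq hw] at h
  have h1 : Real.cosh (dist (hypPoint v) (hypPoint w)) ≤ Real.cosh 0 := by
    rw [Real.cosh_zero]
    have hp := mul_pos (Real.sqrt_pos.2 hv.2) (Real.sqrt_pos.2 hw.2)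
    exact le_of_mul_le_mul_left (by linarith) hp
  rw [Real.cosh_le_cosh, abs_zero, abs_nonpos_iff, dist_eq_zero] at h1
  exact h1

end FutureTimelike

theorem hypPoint_hypVec (z : UpperHalfPlane) : hypPoint (hypVec z) = z := by
  have hz := z.im_pos.ne'
  apply UpperHalfPlane.ext
  apply Complex.ext
  · rw [hypPoint, dif_pos (futureTimelike_hypVec z)]
    simp [hypVec]
    field_simp
  · rw [hypPoint, dif_pos (futureTimelike_hypVec z)]
    change √(lorentz (hypVec z) (hypVec z)) / (hypVec z).1 = z.im
    rw [lorentz_hypVec_self]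
    simp [hypVec]

theorem futureTimelike_combination (x y : UpperHalfPlane) {α β : ℝ} (hα : 0 ≤ α)
    (hβ : 0 ≤ β) (h : 0 < α + β) : FutureTimelike (α • hypVec x + β • hypVec y) :=
  (futureTimelike_hypVec x).smul_add_smul (futureTimelike_hypVec y) hα hβ h

theorem lorentz_combination_self (x y : UpperHalfPlane) (α β : ℝ) :
    lorentz (α • hypVec x + β • hypVec y) (α • hypVec x + β • hypVec y)
      = α ^ 2 + β ^ 2 + 2 * α * β * Real.cosh (dist x y) := by
  simp only [lorentz_add_left, lorentz_add_right, lorentz_smul_left, lorentz_smul_right,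
    lorentz_hypVec, dist_self, Real.cosh_zero, dist_comm y x]
  ring

/-! ### Geodesic segments as nonnegative combinations -/

/-- The position on a geodesic segment of the point with given barycentric coordinates. -/
theorem cosh_dist_combination (x y : UpperHalfPlane) {α β : ℝ} (hα : 0 ≤ α)
    (hβ : 0 ≤ β) (h : 0 < α + β) :
    Real.cosh (dist x (hypPoint (α • hypVec x + β • hypVec y)))
      = (α + β * Real.cosh (dist x y)) / √(α ^ 2 + β ^ 2 + 2 * α * β * Real.cosh (dist x y)) := by
  have hf := futureTimelike_combination x y hα hβ h
  have h1 := (futureTimelike_hypVec x).lorentz_eq hf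
  rw [lorentz_hypVec_self, Real.sqrt_one, one_mul, hypPoint_hypVec] at h1
  rw [← lorentz_combination_self, eq_div_iff (Real.sqrt_pos.2 hf.2).ne', mul_comm, ← h1]
  simp only [lorentz_add_right, lorentz_smul_right, lorentz_hypVec, dist_self, Real.cosh_zero]
  ring

/-- The normalised combination gives explicit `cosh` and `sinh` of the distances to `x` and `y`; the
addition formula then shows that the two distances add up to `dist x y`. -/
theorem hypPoint_combination_mem_hypSegment (x y : UpperHalfPlane) {α β : ℝ} (hα : 0 ≤ α)
    (hβ : 0 ≤ β) (h : 0 < α + β) :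
    hypPoint (α • hypVec x + β • hypVec y) ∈ hypSegment x y := by
  have hf := futureTimelike_combination x y hα hβ h
  have h1 := cosh_dist_combination x y hα hβ h
  have h2 := cosh_dist_combination y x hβ hα (by linarith)
  have h0 := hf.2
  rw [lorentz_combination_self] at h0
  rw [add_comm (β • _), dist_comm y x, show β ^ 2 + α ^ 2 + 2 * β * α * Real.cosh (dist x y)
    = α ^ 2 + β ^ 2 + 2 * α * β * Real.cosh (dist x y) by ring] at h2
  set z := hypPoint (α • hypVec x + β • hypVec y)
  set N := √(α ^ 2 + β ^ 2 + 2 * α * β * Real.cosh (dist x y))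
  have hN : 0 < N := Real.sqrt_pos.2 h0
  have hN2 : N ^ 2 = α ^ 2 + β ^ 2 + 2 * α * β * Real.cosh (dist x y) := Real.sq_sqrt h0.le
  have hs := Real.sinh_nonneg_iff.2 (dist_nonneg (x := x) (y := y))
  have hC := Real.cosh_sq (dist x y)
  have s1 : Real.sinh (dist x z) = β * Real.sinh (dist x y) / N := by
    refine (sq_eq_sq₀ (Real.sinh_nonneg_iff.2 dist_nonneg) (by positivity)).1 ?_
    rw [Real.sinh_sq, h1]
    field_simp
    linear_combination -hN2 + β ^ 2 * hC
  have s2 : Real.sinh (dist y z) = α * Real.sinh (dist x y) / N := by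
    refine (sq_eq_sq₀ (Real.sinh_nonneg_iff.2 dist_nonneg) (by positivity)).1 ?_
    rw [Real.sinh_sq, h2]
    field_simp
    linear_combination -hN2 + α ^ 2 * hC
  have key : Real.cosh (dist x z + dist z y) = Real.cosh (dist x y) := by
    rw [dist_comm z y, Real.cosh_add, h1, h2, s1, s2]
    field_simp
    linear_combination -Real.cosh (dist x y) * hN2 - α * β * hC
  exact Real.cosh_injOn (add_nonneg dist_nonneg dist_nonneg) dist_nonneg key

theorem sinh_dist_sub_nonneg {x y z : UpperHalfPlane} (hz : z ∈ hypSegment x y) :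
    0 ≤ Real.sinh (dist x y - dist x z) := by
  have hz' : dist x z + dist z y = dist x y := hz
  exact Real.sinh_nonneg_iff.2 (by linarith [dist_nonneg (x := z) (y := y)])

theorem sinh_dist_sub_add_pos {x y z : UpperHalfPlane} (hz : z ∈ hypSegment x y)
    (hxy : 0 < dist x y) : 0 < Real.sinh (dist x y - dist x z) + Real.sinh (dist x z) := by
  rcases (dist_nonneg (x := x) (y := z)).eq_or_lt with h | h
  · rw [← h, sub_zero, Real.sinh_zero, add_zero]
    exact Real.sinh_pos_iff.2 hxy
  · linarith [Real.sinh_pos_iff.2 h, sinh_dist_sub_nonneg hz]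

/-- The hyperbolic form of linear interpolation: on the hyperboloid, `sinh d(z,y) · x + sinh d(x,z)
· y = sinh d(x,y) · z`. It is obtained from the equality case `hypPoint_eq_hypPoint`. -/
theorem eq_hypPoint_of_mem_hypSegment {x y z : UpperHalfPlane} (hz : z ∈ hypSegment x y)
    (hxy : 0 < dist x y) :
    z = hypPoint (Real.sinh (dist x y - dist x z) • hypVec x
      + Real.sinh (dist x z) • hypVec y) := by
  have hz' : dist x z + dist z y = dist x y := hz
  have e : dist x y - dist x z = dist z y := by linarith
  have hβ := Real.sinh_nonneg_iff.2 (dist_nonneg (x := x) (y := z))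
  have hf := futureTimelike_combination x y (sinh_dist_sub_nonneg hz) hβ
    (sinh_dist_sub_add_pos hz hxy)
  rw [e] at hf ⊢
  have h0 := Real.sinh_pos_iff.2 hxy
  have hS : Real.sinh (dist x y) = Real.sinh (dist x z) * Real.cosh (dist z y)
      + Real.cosh (dist x z) * Real.sinh (dist z y) := by rw [← hz', Real.sinh_add]
  have hq : lorentz (Real.sinh (dist z y) • hypVec x + Real.sinh (dist x z) • hypVec y)
      (Real.sinh (dist z y) • hypVec x + Real.sinh (dist x z) • hypVec y)
      = Real.sinh (dist x y) ^ 2 := by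
    rw [lorentz_combination_self, hS, ← hz', Real.cosh_add]
    have e1 := Real.cosh_sq (dist x z)
    have e2 := Real.cosh_sq (dist z y)
    linear_combination (-Real.sinh (dist z y) ^ 2) * e1 - Real.sinh (dist x z) ^ 2 * e2
  have := (futureTimelike_hypVec z).hypPoint_eq_hypPoint hf (le_of_eq (by
    rw [hq, Real.sqrt_sq h0.le, lorentz_hypVec_self, Real.sqrt_one, hS]
    simp only [lorentz_add_right, lorentz_smul_right, lorentz_hypVec, dist_comm z x]
    ring))
  rwa [hypPoint_hypVec] at this

/-! ### Barycentric coordinates in hyperbolic triangles -/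

/-- The combination of the vectors which represent the vertices of a triangle. -/
noncomputable def baryVec (p : Fin 3 → UpperHalfPlane) (l : Fin 3 → ℝ) : ℝ × ℝ × ℝ :=
  ∑ i, l i • hypVec (p i)

/-- The point with given (projective) barycentric coordinates in a triangle. -/
noncomputable def baryPoint (p : Fin 3 → UpperHalfPlane) (l : Fin 3 → ℝ) : UpperHalfPlane :=
  hypPoint (baryVec p l)

/-- Admissible barycentric coordinates of the points of a triangle. -/
def IsBary (l : Fin 3 → ℝ) : Prop :=
  (∀ i, 0 ≤ l i) ∧ 0 < ∑ i, l i

theorem baryVec_add (p : Fin 3 → UpperHalfPlane) (l m : Fin 3 → ℝ) :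
    baryVec p (l + m) = baryVec p l + baryVec p m := by
  simp [baryVec, add_smul, Finset.sum_add_distrib]

theorem baryVec_smul (p : Fin 3 → UpperHalfPlane) (c : ℝ) (l : Fin 3 → ℝ) :
    baryVec p (c • l) = c • baryVec p l := by
  simp [baryVec, mul_smul, Finset.smul_sum]

theorem baryVec_single (p : Fin 3 → UpperHalfPlane) (i : Fin 3) (c : ℝ) :
    baryVec p (Pi.single i c) = c • hypVec (p i) := by
  simp [baryVec, Pi.single_apply, ite_smul]

theorem isBary_single (i : Fin 3) : IsBary (Pi.single i 1) :=
  ⟨fun j => by rw [Pi.single_apply]; split_ifs <;> norm_num, by simp⟩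

theorem IsBary.add_smul {l m : Fin 3 → ℝ} (hl : IsBary l) (hm : IsBary m) {α β : ℝ}
    (hα : 0 ≤ α) (hβ : 0 ≤ β) (h : 0 < α + β) : IsBary (α • l + β • m) := by
  refine ⟨fun i => add_nonneg (mul_nonneg hα (hl.1 i)) (mul_nonneg hβ (hm.1 i)), ?_⟩
  have h1 := hl.2
  have h2 := hm.2
  simp only [Pi.add_apply, Pi.smul_apply, smul_eq_mul, Finset.sum_add_distrib, ← Finset.mul_sum]
  rcases hα.eq_or_lt with rfl | hα
  · have : 0 < β := by linarith
    positivity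
  · positivity

/-- Two induction steps build the points of a triangle from its vertices. -/
theorem IsBary.induction {P : (Fin 3 → ℝ) → Prop} (hsingle : ∀ i, P (Pi.single i 1))
    (hadd : ∀ (l m : Fin 3 → ℝ) (α β : ℝ), IsBary l → IsBary m → 0 ≤ α → 0 ≤ β → 0 < α + β → P l → P m →
      P (α • l + β • m)) {l : Fin 3 → ℝ} (hl : IsBary l) : P l := by
  obtain ⟨h0, hs⟩ := hl
  rw [Fin.sum_univ_three] at hs
  by_cases h : 0 < l 0 + l 1
  · have e : l = (1 : ℝ) • (l 0 • (Pi.single 0 1 : Fin 3 → ℝ) + l 1 • Pi.single 1 1)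
        + l 2 • Pi.single 2 1 := by
      ext i; fin_cases i <;> simp
    rw [e]
    have hb : IsBary (l 0 • (Pi.single 0 1 : Fin 3 → ℝ) + l 1 • Pi.single 1 1) :=
      (isBary_single 0).add_smul (isBary_single 1) (h0 0) (h0 1) h
    exact hadd _ _ _ _ hb (isBary_single 2) zero_le_one (h0 2) (by linarith [h0 2])
      (hadd _ _ _ _ (isBary_single 0) (isBary_single 1) (h0 0) (h0 1) h (hsingle 0) (hsingle 1))
      (hsingle 2)
  · have e0 : l 0 = 0 := by linarith [h0 0, h0 1]
    have e1 : l 1 = 0 := by linarith [h0 0, h0 1]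
    -- A multiple of one vertex is also written as a combination of two, with a zero coefficient,
    -- because `hadd` is the only way to rescale.
    have e : l = (0 : ℝ) • (Pi.single 2 1 : Fin 3 → ℝ) + l 2 • Pi.single 2 1 := by
      ext i; fin_cases i <;> simp [e0, e1]
    rw [e]
    exact hadd _ _ _ _ (isBary_single 2) (isBary_single 2) le_rfl (h0 2) (by linarith)
      (hsingle 2) (hsingle 2)

theorem IsBary.futureTimelike (p : Fin 3 → UpperHalfPlane) {l : Fin 3 → ℝ} (hl : IsBary l) :
    FutureTimelike (baryVec p l) := by
  refine hl.induction (P := fun l => FutureTimelike (baryVec p l)) (fun i => ?_) ?_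
  · rw [baryVec_single, one_smul]; exact futureTimelike_hypVec _
  · intro l m α β _ _ hα hβ h h1 h2
    rw [baryVec_add, baryVec_smul, baryVec_smul]
    exact h1.smul_add_smul h2 hα hβ h

theorem baryPoint_single (p : Fin 3 → UpperHalfPlane) (i : Fin 3) :
    baryPoint p (Pi.single i 1) = p i := by
  rw [baryPoint, baryVec_single, one_smul, hypPoint_hypVec]

/-- A combination of two future timelike vectors is on the segment between them. -/
theorem FutureTimelike.hypPoint_mem_hypSegment {v w : ℝ × ℝ × ℝ} (hv : FutureTimelike v)
    (hw : FutureTimelike w) {α β : ℝ} (hα : 0 ≤ α) (hβ : 0 ≤ β) (h : 0 < α + β) :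
    hypPoint (α • v + β • w) ∈ hypSegment (hypPoint v) (hypPoint w) := by
  have hs := Real.sqrt_pos.2 hv.2
  have hs' := Real.sqrt_pos.2 hw.2
  have e : α • v + β • w = (α * √(lorentz v v)) • hypVec (hypPoint v)
      + (β * √(lorentz w w)) • hypVec (hypPoint w) := by
    rw [mul_smul, mul_smul, hv.sqrt_smul_hypVec, hw.sqrt_smul_hypVec]
  rw [e]
  refine hypPoint_combination_mem_hypSegment _ _ (by positivity) (by positivity) ?_
  rcases hα.eq_or_lt with rfl | hα
  · have : 0 < β := by linarith
    positivity
  · positivity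

theorem IsBary.baryPoint_mem_hypHull (p : Fin 3 → UpperHalfPlane) {l : Fin 3 → ℝ}
    (hl : IsBary l) : baryPoint p l ∈ hypHull (Set.range p) := by
  rintro t ⟨ht, hp⟩
  refine hl.induction (P := fun l => baryPoint p l ∈ t) (fun i => ?_) ?_
  · rw [baryPoint_single]; exact hp ⟨i, rfl⟩
  · intro l m α β hl hm hα hβ h h1 h2
    refine ht _ h1 _ h2 ?_
    unfold baryPoint
    rw [baryVec_add, baryVec_smul, baryVec_smul]
    exact (hl.futureTimelike p).hypPoint_mem_hypSegment (hm.futureTimelike p) hα hβ h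

/-- This gives the converse of `IsBary.baryPoint_mem_hypHull`: the hull is contained in this convex
set, so each of its points has barycentric coordinates. -/
theorem hypConvex_setOf_baryPoint (p : Fin 3 → UpperHalfPlane) :
    HypConvex {x | ∃ l, IsBary l ∧ baryPoint p l = x} := by
  rintro _ ⟨l, hl, rfl⟩ _ ⟨m, hm, rfl⟩ z hz
  -- When the endpoints coincide, the `sinh` coefficients both vanish and give no admissible
  -- coordinates.
  rcases (dist_nonneg (x := baryPoint p l) (y := baryPoint p m)).eq_or_lt with h | h
  · have hz' : dist (baryPoint p l) z + dist z (baryPoint p m) = 0 := hz.trans h.symm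
    have : dist (baryPoint p l) z = 0 := by
      linarith [dist_nonneg (x := baryPoint p l) (y := z),
        dist_nonneg (x := z) (y := baryPoint p m)]
    exact ⟨l, hl, dist_eq_zero.1 this⟩
  · have hl' := hl.futureTimelike p
    have hm' := hm.futureTimelike p
    have hs := Real.sqrt_pos.2 hl'.2
    have hs' := Real.sqrt_pos.2 hm'.2
    have e := eq_hypPoint_of_mem_hypSegment hz h
    have hα := sinh_dist_sub_nonneg hz
    have hβ := Real.sinh_nonneg_iff.2 (dist_nonneg (x := baryPoint p l) (y := z))
    have hαβ := sinh_dist_sub_add_pos hz h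
    generalize Real.sinh (dist (baryPoint p l) (baryPoint p m) - dist (baryPoint p l) z) = α
      at e hα hαβ
    generalize Real.sinh (dist (baryPoint p l) z) = β at e hβ hαβ
    -- `α` and `β` refer to unit vectors, whereas `baryVec p l` and `baryVec p m` are not
    -- normalised; hence the division by their Lorentz norms.
    refine ⟨(α / √(lorentz (baryVec p l) (baryVec p l))) • l
      + (β / √(lorentz (baryVec p m) (baryVec p m))) • m,
      hl.add_smul hm (by positivity) (by positivity) ?_, ?_⟩
    · rcases hα.eq_or_lt with rfl | hα
      · have : 0 < β := by linarith
        positivity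
      · positivity
    · rw [e, baryPoint, baryVec_add, baryVec_smul, baryVec_smul]
      congr 2
      · conv_lhs => rw [← hl'.sqrt_smul_hypVec]
        rw [smul_smul, hl'.sqrt_smul_hypVec, div_mul_cancel₀ _ hs.ne']; rfl
      · conv_lhs => rw [← hm'.sqrt_smul_hypVec]
        rw [smul_smul, hm'.sqrt_smul_hypVec, div_mul_cancel₀ _ hs'.ne']; rfl

theorem exists_baryPoint_of_mem_hypHull {p : Fin 3 → UpperHalfPlane} {x : UpperHalfPlane}
    (hx : x ∈ hypHull (Set.range p)) : ∃ l, IsBary l ∧ baryPoint p l = x :=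
  hx _ ⟨hypConvex_setOf_baryPoint p, by
    rintro _ ⟨i, rfl⟩; exact ⟨_, isBary_single i, baryPoint_single p i⟩⟩

theorem baryVec_side (p : Fin 3 → UpperHalfPlane) (s t : Fin 3) (α β : ℝ) :
    baryVec p (α • Pi.single s 1 + β • Pi.single t 1)
      = α • hypVec (p s) + β • hypVec (p t) := by
  rw [baryVec_add, baryVec_smul, baryVec_smul, baryVec_single, baryVec_single, one_smul, one_smul]

theorem lorentz_baryVec_self (p : Fin 3 → UpperHalfPlane) (l : Fin 3 → ℝ) :
    lorentz (baryVec p l) (baryVec p l) = l 0 ^ 2 + l 1 ^ 2 + l 2 ^ 2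
      + 2 * (l 1 * l 2 * Real.cosh (dist (p 1) (p 2)) + l 0 * l 2 * Real.cosh (dist (p 2) (p 0))
        + l 0 * l 1 * Real.cosh (dist (p 0) (p 1))) := by
  simp only [baryVec, Fin.sum_univ_three, lorentz_add_left, lorentz_add_right, lorentz_smul_left,
    lorentz_smul_right, lorentz_hypVec, dist_self, Real.cosh_zero, dist_comm (p 1) (p 0),
    dist_comm (p 2) (p 1), dist_comm (p 0) (p 2)]
  ring

theorem lorentz_baryVec_sub_smul (p : Fin 3 → UpperHalfPlane) (l m : Fin 3 → ℝ) (t : ℝ) :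
    lorentz (baryVec p (l + (-t) • m)) (baryVec p (l + (-t) • m))
      = lorentz (baryVec p l) (baryVec p l) - 2 * t * lorentz (baryVec p l) (baryVec p m)
        + t ^ 2 * lorentz (baryVec p m) (baryVec p m) := by
  simp only [baryVec_add, baryVec_smul, lorentz_add_left, lorentz_add_right, lorentz_smul_left,
    lorentz_smul_right, lorentz_comm (baryVec p m) (baryVec p l)]
  ring

/-! ### Barycentric maps and distances -/

/-- When the three sides of a triangle grow by the same length, the distance between the points
with given barycentric coordinates does not decrease. -/
theorem dist_baryPoint_le {p p' : Fin 3 → UpperHalfPlane} {ε : ℝ} (hε : 0 ≤ ε)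
    (h : ∀ i, dist (p' (i + 1)) (p' (i + 2)) = dist (p (i + 1)) (p (i + 2)) + ε)
    {l m : Fin 3 → ℝ} (hl : IsBary l) (hm : IsBary m) :
    dist (baryPoint p l) (baryPoint p m) ≤ dist (baryPoint p' l) (baryPoint p' m) := by
  have hl1 := hl.futureTimelike p
  have hm1 := hm.futureTimelike p
  have hl2 := hl.futureTimelike p'
  have hm2 := hm.futureTimelike p'
  have h0 : dist (p' 1) (p' 2) = dist (p 1) (p 2) + ε := h 0
  have h1 : dist (p' 2) (p' 0) = dist (p 2) (p 0) + ε := h 1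
  have h2 : dist (p' 0) (p' 1) = dist (p 0) (p 1) + ε := h 2
  -- Both Gram forms are restricted to the pencil `l - t m`; its members may have negative
  -- coordinates, so the cone inclusion is needed for all sign patterns.
  have key := cross_sq_mul_le hl1.2 hm1.2 (hl1.lorentz_pos hm1) hl2.2 hm2.2
    (hl1.mul_le_sq hm1) (w' := lorentz (baryVec p' l) (baryVec p' m)) (fun t ht => by
      rw [← lorentz_baryVec_sub_smul, lorentz_baryVec_self] at ht ⊢
      rw [h0, h1, h2]
      refine cosh_add_form_nonpos ?_ ?_ ?_ dist_nonneg dist_nonneg dist_nonneg hε ht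
      · linarith [dist_triangle (p 1) (p 0) (p 2), dist_comm (p 0) (p 1), dist_comm (p 0) (p 2)]
      · linarith [dist_triangle (p 2) (p 1) (p 0), dist_comm (p 0) (p 1), dist_comm (p 1) (p 2)]
      · linarith [dist_triangle (p 0) (p 2) (p 1), dist_comm (p 0) (p 2), dist_comm (p 1) (p 2)])
  rw [hl1.lorentz_eq hm1, hl2.lorentz_eq hm2] at key
  simp only [mul_pow, Real.sq_sqrt hl1.2.le, Real.sq_sqrt hm1.2.le, Real.sq_sqrt hl2.2.le,
    Real.sq_sqrt hm2.2.le] at key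
  have hpos := mul_pos (mul_pos hl1.2 hm1.2) (mul_pos hl2.2 hm2.2)
  have h3 : Real.cosh (dist (baryPoint p l) (baryPoint p m)) ^ 2
      ≤ Real.cosh (dist (baryPoint p' l) (baryPoint p' m)) ^ 2 := by
    refine le_of_mul_le_mul_left ?_ hpos
    simp only [baryPoint]
    linarith
  have h4 := (sq_le_sq₀ (Real.cosh_pos _).le (Real.cosh_pos _).le).1 h3
  rwa [Real.cosh_le_cosh, abs_of_nonneg dist_nonneg, abs_of_nonneg dist_nonneg] at h4

theorem hypSegment_comm (x y : UpperHalfPlane) : hypSegment x y = hypSegment y x := by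
  ext z
  change dist x z + dist z y = dist x y ↔ dist y z + dist z x = dist y x
  rw [dist_comm x z, dist_comm z y, dist_comm x y, add_comm]

namespace LengthFunction

variable {V E F : Type*} {T : SurfaceTriangulation V E F}

theorem not_flattensFace_perturb (ℓ : LengthFunction T) {ε : ℝ} (hε : 0 < ε) (f : F) :
    ¬ (ℓ.perturb ε hε.le).FlattensFace f := by
  rintro ⟨i, hi⟩
  have h := ℓ.triangle_le f i
  simp only [perturb] at hi
  linarith

/-! ### Oriented sides -/

/-- The point of the triangle `Δ_f` at which its side number `i` ends. -/
noncomputable def sideEnd (ℓ : LengthFunction T) (f : F) (i : Fin 3) : UpperHalfPlane :=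
  ℓ.vertex f (bif T.forward f i then i + 2 else i + 1)

theorem triangleSide_eq (ℓ : LengthFunction T) (f : F) (i : Fin 3) :
    ℓ.triangleSide f i = hypSegment (ℓ.sideStart f i) (ℓ.sideEnd f i) := by
  unfold triangleSide sideStart sideEnd
  cases T.forward f i
  · exact hypSegment_comm _ _
  · rfl

theorem dist_sideStart_sideEnd (ℓ : LengthFunction T) (f : F) (i : Fin 3) :
    dist (ℓ.sideStart f i) (ℓ.sideEnd f i) = ℓ.len (T.side f i) := by
  rw [← ℓ.dist_vertex f i]
  unfold sideStart sideEnd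
  cases T.forward f i
  · exact dist_comm _ _
  · rfl

/-! ### The contraction of a triangle -/

variable (ℓ : LengthFunction T) (ε : ℝ) (hε : 0 < ε)

theorem dist_vertex_perturb (f : F) (i : Fin 3) :
    dist ((ℓ.perturb ε hε.le).vertex f (i + 1)) ((ℓ.perturb ε hε.le).vertex f (i + 2))
      = dist (ℓ.vertex f (i + 1)) (ℓ.vertex f (i + 2)) + ε := by
  rw [dist_vertex, dist_vertex]
  rfl

/-- The map from the triangle with side lengths `ℓ + ε` to the triangle with side lengths `ℓ`
which preserves the barycentric coordinates. -/
noncomputable def contraction (f : F) (x : (ℓ.perturb ε hε.le).triangle f) : ℓ.triangle f :=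
  ⟨baryPoint (ℓ.vertex f) (exists_baryPoint_of_mem_hypHull x.2).choose,
    (exists_baryPoint_of_mem_hypHull x.2).choose_spec.1.baryPoint_mem_hypHull _⟩

theorem exists_contraction_eq (f : F) (x : (ℓ.perturb ε hε.le).triangle f) :
    ∃ l, IsBary l ∧ x.1 = baryPoint ((ℓ.perturb ε hε.le).vertex f) l ∧
      (ℓ.contraction ε hε f x).1 = baryPoint (ℓ.vertex f) l :=
  ⟨_, (exists_baryPoint_of_mem_hypHull x.2).choose_spec.1,
    (exists_baryPoint_of_mem_hypHull x.2).choose_spec.2.symm, rfl⟩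

theorem dist_contraction_le (f : F) (x y : (ℓ.perturb ε hε.le).triangle f) :
    dist (ℓ.contraction ε hε f x).1 (ℓ.contraction ε hε f y).1 ≤ dist x.1 y.1 := by
  obtain ⟨l, hl, hx, hx'⟩ := ℓ.exists_contraction_eq ε hε f x
  obtain ⟨m, hm, hy, hy'⟩ := ℓ.exists_contraction_eq ε hε f y
  rw [hx, hx', hy, hy']
  exact dist_baryPoint_le hε.le (ℓ.dist_vertex_perturb ε hε f) hl hm

theorem lipschitzWith_contraction (f : F) : LipschitzWith 1 (ℓ.contraction ε hε f) :=
  LipschitzWith.of_dist_le_mul fun x y => by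
    rw [NNReal.coe_one, one_mul]
    exact ℓ.dist_contraction_le ε hε f x y

/-- Independence of the chosen coordinates comes from the distance estimate itself: two systems of
coordinates of one point have images at distance at most `0`. Neither uniqueness of coordinates nor
nondegeneracy is needed. -/
theorem contraction_baryPoint (f : F) {x : (ℓ.perturb ε hε.le).triangle f} {l : Fin 3 → ℝ}
    (hl : IsBary l) (hx : x.1 = baryPoint ((ℓ.perturb ε hε.le).vertex f) l) :
    (ℓ.contraction ε hε f x).1 = baryPoint (ℓ.vertex f) l := by
  obtain ⟨m, hm, hx', hm'⟩ := ℓ.exists_contraction_eq ε hε f x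
  have h := dist_baryPoint_le hε.le (ℓ.dist_vertex_perturb ε hε f) hm hl
  rw [← hx', ← hx, dist_self] at h
  rw [hm']
  exact dist_le_zero.1 h

theorem contraction_vertex (f : F) (i : Fin 3) {x : (ℓ.perturb ε hε.le).triangle f}
    (hx : x.1 = (ℓ.perturb ε hε.le).vertex f i) :
    (ℓ.contraction ε hε f x).1 = ℓ.vertex f i := by
  rw [← baryPoint_single ((ℓ.perturb ε hε.le).vertex f)] at hx
  rw [← baryPoint_single (ℓ.vertex f)]
  exact ℓ.contraction_baryPoint ε hε f (isBary_single i) hx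

/-- The image of a point of a side of a triangle depends only on its position on the side. -/
theorem contraction_side (f : F) (i : Fin 3) {x : (ℓ.perturb ε hε.le).triangle f}
    (hx : x.1 ∈ (ℓ.perturb ε hε.le).triangleSide f i) :
    ∃ α β : ℝ, α = Real.sinh (ℓ.len (T.side f i) + ε
        - dist ((ℓ.perturb ε hε.le).sideStart f i) x.1) ∧
      β = Real.sinh (dist ((ℓ.perturb ε hε.le).sideStart f i) x.1) ∧
      0 ≤ α ∧ 0 ≤ β ∧ 0 < α + β ∧
      (ℓ.contraction ε hε f x).1
        = hypPoint (α • hypVec (ℓ.sideStart f i) + β • hypVec (ℓ.sideEnd f i)) := by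
  rw [triangleSide_eq] at hx
  have hd : dist ((ℓ.perturb ε hε.le).sideStart f i) ((ℓ.perturb ε hε.le).sideEnd f i)
      = ℓ.len (T.side f i) + ε := dist_sideStart_sideEnd _ f i
  have hpos : 0 < dist ((ℓ.perturb ε hε.le).sideStart f i)
      ((ℓ.perturb ε hε.le).sideEnd f i) := by
    rw [hd]; linarith [ℓ.nonneg (T.side f i)]
  have h1 := sinh_dist_sub_nonneg hx
  have h2 := Real.sinh_nonneg_iff.2
    (dist_nonneg (x := (ℓ.perturb ε hε.le).sideStart f i) (y := x.1))
  have h3 := sinh_dist_sub_add_pos hx hpos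
  have h4 := eq_hypPoint_of_mem_hypSegment hx hpos
  rw [hd] at h1 h3 h4
  refine ⟨_, _, rfl, rfl, h1, h2, h3, ?_⟩
  unfold sideStart sideEnd at h4 ⊢
  rw [← baryVec_side] at h4 ⊢
  exact ℓ.contraction_baryPoint ε hε f
    ((isBary_single _).add_smul (isBary_single _) h1 h2 h3) h4

theorem contraction_mem_triangleSide (f : F) (i : Fin 3) {x : (ℓ.perturb ε hε.le).triangle f}
    (hx : x.1 ∈ (ℓ.perturb ε hε.le).triangleSide f i) :
    (ℓ.contraction ε hε f x).1 ∈ ℓ.triangleSide f i := by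
  obtain ⟨α, β, -, -, h1, h2, h3, h4⟩ := ℓ.contraction_side ε hε f i hx
  rw [triangleSide_eq, h4]
  exact hypPoint_combination_mem_hypSegment _ _ h1 h2 h3

/-- The two images have the same weights `α`, `β` along sides of the same length, hence the same
position on the edge. This makes the triangle maps compatible with the gluing. -/
theorem dist_sideStart_contraction_eq {f g : F} {i j : Fin 3} (hs : T.side f i = T.side g j)
    {x : (ℓ.perturb ε hε.le).triangle f} {y : (ℓ.perturb ε hε.le).triangle g}
    (hx : x.1 ∈ (ℓ.perturb ε hε.le).triangleSide f i)
    (hy : y.1 ∈ (ℓ.perturb ε hε.le).triangleSide g j)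
    (hd : dist ((ℓ.perturb ε hε.le).sideStart f i) x.1
      = dist ((ℓ.perturb ε hε.le).sideStart g j) y.1) :
    dist (ℓ.sideStart f i) (ℓ.contraction ε hε f x).1
      = dist (ℓ.sideStart g j) (ℓ.contraction ε hε g y).1 := by
  obtain ⟨α, β, hα, hβ, h1, h2, h3, h4⟩ := ℓ.contraction_side ε hε f i hx
  obtain ⟨α', β', hα', hβ', -, -, -, h4'⟩ := ℓ.contraction_side ε hε g j hy
  obtain rfl : α = α' := by rw [hα, hα', hs, hd]
  obtain rfl : β = β' := by rw [hβ, hβ', hd]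
  refine Real.cosh_injOn dist_nonneg dist_nonneg ?_
  rw [h4, h4', cosh_dist_combination _ _ h1 h2 h3, cosh_dist_combination _ _ h1 h2 h3,
    dist_sideStart_sideEnd, dist_sideStart_sideEnd, hs]

/-! ### The contraction of the surface -/

/-- The contractions of the triangles, as a map between the disjoint unions. -/
noncomputable def contractionPoint (x : (ℓ.perturb ε hε.le).Point) : ℓ.Point :=
  ⟨x.face, (ℓ.contraction ε hε x.face ⟨x.pos, x.mem⟩).1,
    (ℓ.contraction ε hε x.face ⟨x.pos, x.mem⟩).2⟩

theorem Glued.contractionPoint {x y : (ℓ.perturb ε hε.le).Point}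
    (h : (ℓ.perturb ε hε.le).Glued x y) :
    ℓ.Glued (ℓ.contractionPoint ε hε x) (ℓ.contractionPoint ε hε y) := by
  obtain ⟨i, j, hs, hx, hy, hd⟩ := h
  exact ⟨i, j, hs, ℓ.contraction_mem_triangleSide ε hε _ i hx,
    ℓ.contraction_mem_triangleSide ε hε _ j hy,
    ℓ.dist_sideStart_contraction_eq ε hε hs (x := ⟨x.pos, x.mem⟩) (y := ⟨y.pos, y.mem⟩) hx hy hd⟩

theorem dist_contractionPoint_le {x y : (ℓ.perturb ε hε.le).Point} (h : x.face = y.face) :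
    dist (ℓ.contractionPoint ε hε x).pos (ℓ.contractionPoint ε hε y).pos
      ≤ dist x.pos y.pos := by
  obtain ⟨f, x, hx⟩ := x
  obtain ⟨g, y, hy⟩ := y
  obtain rfl : f = g := h
  exact ℓ.dist_contraction_le ε hε f ⟨x, hx⟩ ⟨y, hy⟩

/-- Moves inside a triangle do not get longer and jumps go to jumps, so taking infima over chains
yields the Lipschitz bound for the quotient pseudo-distance. -/
theorem Chain.contractionPoint {x y : (ℓ.perturb ε hε.le).Point} {r : ℝ}
    (h : (ℓ.perturb ε hε.le).Chain x y r) :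
    ∃ s ≤ r, ℓ.Chain (ℓ.contractionPoint ε hε x) (ℓ.contractionPoint ε hε y) s := by
  induction h with
  | refl => exact ⟨0, le_rfl, Chain.refl _⟩
  | move _ hf ih =>
    obtain ⟨s, hs, hc⟩ := ih
    exact ⟨_, add_le_add hs (ℓ.dist_contractionPoint_le ε hε hf), hc.move hf⟩
  | glue _ hg ih =>
    obtain ⟨s, hs, hc⟩ := ih
    exact ⟨s, hs, hc.glue (hg.contractionPoint ℓ ε hε)⟩

theorem lipschitzWith_contractionPoint : LipschitzWith 1 (ℓ.contractionPoint ε hε) := by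
  intro x y
  rw [ENNReal.coe_one, one_mul]
  refine le_iInf₂ fun r hr => ?_
  obtain ⟨s, hs, hc⟩ := hr.contractionPoint ℓ ε hε
  exact (iInf₂_le (f := fun r _ => ENNReal.ofReal r) s hc).trans (ENNReal.ofReal_le_ofReal hs)

/-- The contraction of the conical surface. -/
noncomputable def contractionCone : (ℓ.perturb ε hε.le).ConeStructure → ℓ.ConeStructure :=
  SeparationQuotient.lift (fun x => SeparationQuotient.mk (ℓ.contractionPoint ε hε x))
    -- Points at distance `0` are topologically inseparable, a relation preserved by continuous
    -- maps.
    fun _ _ h => SeparationQuotient.mk_eq_mk.2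
      (h.map (ℓ.lipschitzWith_contractionPoint ε hε).continuous)

theorem lipschitzWith_contractionCone : LipschitzWith 1 (ℓ.contractionCone ε hε) := by
  intro x y
  obtain ⟨x, rfl⟩ := SeparationQuotient.surjective_mk x
  obtain ⟨y, rfl⟩ := SeparationQuotient.surjective_mk y
  exact ℓ.lipschitzWith_contractionPoint ε hε x y

end LengthFunction

theorem mainTheorem6 {V E F : Type*} (T : SurfaceTriangulation V E F) (ℓ : LengthFunction T)
    (ε : ℝ) (hε : 0 < ε) :
    (∀ f, ¬ (ℓ.perturb ε hε.le).FlattensFace f) ∧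
    ∃ Φ : (ℓ.perturb ε hε.le).ConeStructure → ℓ.ConeStructure,
      LipschitzWith 1 Φ ∧
      ∃ φ : ∀ f, (ℓ.perturb ε hε.le).triangle f → ℓ.triangle f,
        (∀ f x, Φ ((ℓ.perturb ε hε.le).toCone f x) = ℓ.toCone f (φ f x)) ∧
        (∀ f, LipschitzWith 1 (φ f)) ∧
        (∀ f i x, x.1 = (ℓ.perturb ε hε.le).vertex f i → (φ f x).1 = ℓ.vertex f i) ∧
        (∀ f i x, x.1 ∈ (ℓ.perturb ε hε.le).triangleSide f i →
          (φ f x).1 ∈ ℓ.triangleSide f i) :=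
  ⟨ℓ.not_flattensFace_perturb hε, ℓ.contractionCone ε hε, ℓ.lipschitzWith_contractionCone ε hε,
    ℓ.contraction ε hε, fun _ _ => rfl, ℓ.lipschitzWith_contraction ε hε,
    fun f i _ hx => ℓ.contraction_vertex ε hε f i hx,
    fun f i _ hx => ℓ.contraction_mem_triangleSide ε hε f i hx⟩
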